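/- Let $1\le k<r$, let $N_1,\dots,N_r\ge 2$ be integers, and put $m=N_1\cdots N_k$, $n=N_{k+1}\cdots N_r$. Assume $m\ge n$. Let $R$ be a commutative $\mathbb{Q}$-algebra and let $z_1,\dots,z_{mn}\in R^r$; write $z_i=(z_i',z_i'')$, where $z_i'$ consists of the first $k$ coordinates of $z_i$ and $z_i''$ of the last $r-k$. For a sequence $M=(M_1,\dots,M_s)$ of positive integers let $E_M$ be the list of the monomials $x_1^{a_1}\cdots x_s^{a_s}$ with $0\le a_i\le M_i-1$, in the order in which the first variable runs fastest: $x^a$ stands in position $1+\sum_i a_iM_1\cdots M_{i-1}$ (for example $E_{(3,2)}=(1,x,x^2,y,xy,x^2y)$). For $K=M_1\cdots M_s$ points $w_1,\dots,w_K\in R^s$ let $V_M(w_1,\dots,w_K)$ be the $K\times K$ matrix whose entry $(i,j)$ is the $j$-th monomial of $E_M$ evaluated at $w_i$. Let $1_{n^m}$ be the array with $m$ rows and $n$ columns whose entry in row $i$ and column $j$ is $i+m(j-1)$. For a permutation $\sigma\in\Sigma_{mn}$ of $\{1,\dots,mn\}$ let ${}^\sigma 1_{n^m}$ be the array with entries $\sigma(i+m(j-1))$,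 let $\mathrm{col}_j({}^\sigma 1_{n^m})$ be its $j$-th column read from top to bottom, and $\mathrm{row}_i({}^\sigma 1_{n^m})$ its $i$-th row read from left to right. Let $\varepsilon(\sigma)$ be the sign of $\sigma$, and put \[ H_{m,n}=\prod_{i=0}^{n-1}\frac{(m+i)!}{i!}. \] Then \[ \det V_{(N_1,\dots,N_r)}(z_1,\dots,z_{mn})=\frac1{H_{m,n}}\sum_{\sigma\in\Sigma_{mn}}\varepsilon(\sigma)\prod_{j=1}^{n}\det V_{(N_1,\dots,N_k)}\bigl(z'_a,\ a\in\mathrm{col}_j({}^\sigma 1_{n^m})\bigr)\prod_{i=1}^{m}\det V_{(N_{k+1},\dots,N_r)}\bigl(z''_b,\ b\in\mathrm{row}_i({}^\sigma 1_{n^m})\bigr). \] If instead, in all three kinds of matrices $V$, the monomials are ordered degree-lexicographically (first by ascending total degree, then within each degree in dictionary order $x^2,xy,y^2$), the same formula holds with its right-hand side multiplied by the sign $s_{(N_1,\dots,N_r)}\,s_{(N_1,\dots,N_k)}^{\,n}\,s_{(N_{k+1},\dots,N_r)}^{\,m}$, where $s_M\in\{1,-1\}$ is the sign of the permutation between the degree-lexicographic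 list of the monomials and $E_M$. -/

import Mathlib

namespace MultiVandermonde

/-- Exponent vectors of the monomials of degree at most `N i - 1` in the `i`-th variable. -/
abbrev Expo {r : ℕ} (N : Fin r → ℕ) : Type := (i : Fin r) → Fin (N i)

/-- The monomial `z ^ a` evaluated at the point `z`. -/
def monomialAt {R : Type*} [CommRing R] {r : ℕ} {N : Fin r → ℕ} (a : Expo N) (z : Fin r → R) : R :=
  ∏ i, z i ^ (a i : ℕ)

theorem card_expo {r m : ℕ} (N : Fin r → ℕ) (h : m = ∏ i, N i) : Fintype.card (Expo N) = m := by
  simp [h, Fintype.card_pi]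

/-- The list of monomials in Kronecker order (the first variable runs fastest): the monomial with
exponents `a` stands in position `∑ i, a i * ∏ j < i, N j`, counted from `0`. For `N = (3, 2)` the
list is `1, x, x², y, x y, x² y`. -/
def kroneckerEnum {r m : ℕ} (N : Fin r → ℕ) (h : m = ∏ i, N i) : Fin m ≃ Expo N :=
  (finCongr h).trans finPiFinEquiv.symm

/-- The sorting key of the degree-lexicographic order: first the total degree, ascending; then, in
a fixed degree, the dictionary order `x² , x y , y²` of monomials, in which a larger exponent of
the earliest variable comes first. -/
def degLexKey {r : ℕ} {N : Fin r → ℕ} (a : Expo N) : ℕ ×ₗ Lex (Fin r → ℕᵒᵈ) :=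
  toLex (∑ i, (a i : ℕ), toLex fun i => OrderDual.toDual (a i : ℕ))

theorem degLexKey_injective {r : ℕ} (N : Fin r → ℕ) :
    Function.Injective (degLexKey (N := N)) := by
  intro a b h
  have h2 := congrArg (fun p => (ofLex (ofLex p).2)) h
  funext i
  exact Fin.ext (congrArg OrderDual.ofDual (congrFun h2 i))

/-- The list of monomials in degree-lexicographic order. For `N = (3, 2)` it is
`1, x, y, x², x y, x² y`. -/
noncomputable def degLexEnum {r m : ℕ} (N : Fin r → ℕ) (h : m = ∏ i, N i) : Fin m ≃ Expo N :=
  letI : LinearOrder (Expo N) := LinearOrder.lift' degLexKey (degLexKey_injective N)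
  (Fintype.orderIsoFinOfCardEq (Expo N) (card_expo N h)).toEquiv

/-- The multivariable Vandermonde matrix of the points `z 0, …, z (m - 1)`, whose columns are the
monomials in the order given by `e`. -/
def vandermonde {R : Type*} [CommRing R] {r m : ℕ} {N : Fin r → ℕ} (e : Fin m ≃ Expo N)
    (z : Fin m → Fin r → R) : Matrix (Fin m) (Fin m) R :=
  Matrix.of fun i j => monomialAt (e j) (z i)

/-- The sign of the permutation that relates the two orders on the monomials. -/
noncomputable def orderSign {r m : ℕ} (N : Fin r → ℕ) (h : m = ∏ i, N i) : ℤˣ :=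
  Equiv.Perm.sign ((degLexEnum N h).trans (kroneckerEnum N h).symm)

/-- The first `k` entries of a vector of length `k + l`. -/
abbrev firstPart {k l : ℕ} {α : Type*} (v : Fin (k + l) → α) : Fin k → α :=
  fun i => v (Fin.castAdd l i)

/-- The last `l` entries of a vector of length `k + l`. -/
abbrev secondPart {k l : ℕ} {α : Type*} (v : Fin (k + l) → α) : Fin l → α :=
  fun j => v (Fin.natAdd k j)

theorem mul_eq_prod {k l m n : ℕ} {N : Fin (k + l) → ℕ} (hm : m = ∏ i, firstPart N i)
    (hn : n = ∏ j, secondPart N j) : m * n = ∏ i, N i := by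
  rw [hm, hn, Fin.prod_univ_add]

/-- The tableau with `m` rows and `n` columns filled consecutively from top to bottom, then from
left to right. Entries are counted from `0`. -/
def trivialTableau (m n : ℕ) (i : Fin m) (j : Fin n) : Fin (m * n) :=
  ⟨i + m * j, by
    calc (i : ℕ) + m * j < m + m * j := by have := i.isLt; omega
      _ = m * (j + 1) := by ring
      _ ≤ m * n := Nat.mul_le_mul_left m j.isLt⟩

/-- The tableau obtained from a tableau by permuting its entries. -/
def permTableau {m n : ℕ} (σ : Equiv.Perm (Fin (m * n))) (t : Fin m → Fin n → Fin (m * n)) :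
    Fin m → Fin n → Fin (m * n) :=
  fun i j => σ (t i j)

/-- The `j`-th column of a tableau, from top to bottom. -/
def tabCol {m n : ℕ} (t : Fin m → Fin n → Fin (m * n)) (j : Fin n) : Fin m → Fin (m * n) :=
  fun i => t i j

/-- The `i`-th row of a tableau, from left to right. -/
def tabRow {m n : ℕ} (t : Fin m → Fin n → Fin (m * n)) (i : Fin m) : Fin n → Fin (m * n) :=
  fun j => t i j

/-- The product `H_{m,n}` of the hook lengths of an `m × n` rectangle. -/
def hookProduct (m n : ℕ) : ℚ :=
  ∏ i ∈ Finset.range n, ((m + i).factorial : ℚ) / (i.factorial : ℚ)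

/-- The signed sum over all permutations of the products of Vandermonde determinants along the
columns and the rows of the permuted tableau, where `e'` and `e''` order the monomials in the first
and the second group of variables. -/
def tableauSum {R : Type*} [CommRing R] {k l m n : ℕ} {N : Fin (k + l) → ℕ}
    (e' : Fin m ≃ Expo (firstPart N)) (e'' : Fin n ≃ Expo (secondPart N))
    (z : Fin (m * n) → Fin (k + l) → R) : R :=
  ∑ σ : Equiv.Perm (Fin (m * n)), ((Equiv.Perm.sign σ : ℤ) : R) *
    ((∏ j : Fin n, (vandermonde e'
        fun a => firstPart (z (tabCol (permTableau σ (trivialTableau m n)) j a))).det) *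
      ∏ i : Fin m, (vandermonde e''
        fun b => secondPart (z (tabRow (permTableau σ (trivialTableau m n)) i b))).det)

end MultiVandermonde

namespace MultiVandermonde

open MvPolynomial Matrix Equiv

/-! In Kronecker order each monomial factors into one in the first variables and one in the last,
and its position is the matching entry of the rectangle. Hence the big matrix has the form `W c d =
A c d.1 * B c d.2` on cells `c`, `d` of the rectangle.

Expand every column determinant over a permutation `τ j` and every row determinant over `ρ i`. For
fixed `τ`, `ρ` the sum over `σ` is the determinant of `W` with its columns selected by `cellMap τ
ρ`, hence `mapSign (cellMap τ ρ) * det W`. So the tableau sum is `det W` times a universal constant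
(`sum_sign_prod_det_mul_prod_det`).

That constant is the apolar norm of `det ^ n` for a generic `m × m` matrix
(`sum_sign_mapSign_cellMap`). Multiplication by `det` is adjoint to Cayley's operator, so Cayley's
identity evaluates the norm by induction on `n` and gives `hookProduct m n`. Cayley's identity
follows from a Capelli-type identity, since powers of `det` are eigenvectors of the polarizations.
Changing the order of the monomials only permutes columns. -/

/-! ### Derivations of products and determinants -/

theorem derivation_prod {K A ι : Type*} [CommRing K] [CommRing A] [Algebra K A] [Fintype ι]
    [DecidableEq ι] (D : Derivation K A A) (g : ι → A) :
    D (∏ i, g i) = ∑ i, ∏ j, Function.update g i (D (g i)) j := by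
  have h : ∀ s : Finset ι,
      D (∏ i ∈ s, g i) = ∑ i ∈ s, ∏ j ∈ s, Function.update g i (D (g i)) j := by
    intro s
    induction s using Finset.induction_on with
    | empty => simp
    | insert a s ha ih =>
      have hc : ∏ j ∈ s, Function.update g a (D (g a)) j = ∏ j ∈ s, g j :=
        Finset.prod_congr rfl fun j hj =>
          Function.update_of_ne (ne_of_mem_of_not_mem hj ha) _ _
      rw [Finset.prod_insert ha, D.leibniz, ih, Finset.sum_insert ha, Finset.prod_insert ha, hc,
        Function.update_self, smul_eq_mul, smul_eq_mul, Finset.mul_sum, add_comm, mul_comm]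
      congr 1
      refine Finset.sum_congr rfl fun i hi => ?_
      rw [Finset.prod_insert ha, Function.update_of_ne (ne_of_mem_of_not_mem hi ha).symm]
  exact h Finset.univ

theorem derivation_det {K A ι : Type*} [CommRing K] [CommRing A] [Algebra K A] [Fintype ι]
    [DecidableEq ι] (D : Derivation K A A) (M : Matrix ι ι A) :
    D M.det = ∑ i, (M.updateRow i fun j => D (M i j)).det := by
  have h : ∀ M : Matrix ι ι A,
      M.det = ∑ σ : Perm ι, ((Perm.sign σ : ℤ) : A) * ∏ i, M i (σ i) := fun M => by
    rw [← det_transpose, det_apply']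
    rfl
  simp_rw [h]
  rw [map_sum, Finset.sum_comm]
  refine Finset.sum_congr rfl fun σ _ => ?_
  rw [D.leibniz, D.map_intCast, smul_zero, add_zero, smul_eq_mul, derivation_prod, Finset.mul_sum]
  refine Finset.sum_congr rfl fun i _ => ?_
  congr 1
  refine Finset.prod_congr rfl fun j _ => ?_
  by_cases hj : j = i
  · subst hj
    simp
  · simp [hj]

/-! ### Polarization operators and a Capelli-type identity -/

/-- The iterated partial derivative along the variables `w 0, …, w (k - 1)`. -/
noncomputable def iteratedPDeriv {σ : Type*} : {k : ℕ} → (Fin k → σ) →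
    MvPolynomial σ ℚ →ₗ[ℚ] MvPolynomial σ ℚ
  | 0, _ => LinearMap.id
  | _ + 1, w => (pderiv (w 0)).toLinearMap ∘ₗ iteratedPDeriv (Fin.tail w)

/-- The polarization operator `∑ a, x_{u a} ∂_{v a}`. -/
noncomputable def polarization {m : ℕ} (u v : Fin m) :
    Derivation ℚ (MvPolynomial (Fin m × Fin m) ℚ) (MvPolynomial (Fin m × Fin m) ℚ) :=
  ∑ a, (X (u, a) : MvPolynomial (Fin m × Fin m) ℚ) • pderiv (v, a)

theorem polarization_apply {m : ℕ} (u v : Fin m) (f : MvPolynomial (Fin m × Fin m) ℚ) :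
    polarization u v f = ∑ a, X (u, a) * pderiv (v, a) f := by
  rw [polarization, ← Derivation.coeFnAddMonoidHom_apply, map_sum, Finset.sum_apply]
  rfl

theorem polarization_X {m : ℕ} (u v i a : Fin m) :
    polarization u v (X (i, a)) = if v = i then X (u, a) else 0 := by
  rw [polarization_apply]
  simp only [pderiv_X, Pi.single_apply, Prod.mk.injEq]
  by_cases h : v = i
  · simp [h]
  · simp [h, Ne.symm h]

/-- The operator replaces row `v` by row `u` and kills all other rows, so for `u ≠ v` a repeated row
appears. -/
theorem polarization_det {m : ℕ} (u v : Fin m) :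
    polarization u v (mvPolynomialX (Fin m) (Fin m) ℚ).det =
      if u = v then (mvPolynomialX (Fin m) (Fin m) ℚ).det else 0 := by
  rw [derivation_det, Finset.sum_eq_single v]
  · have hr : (fun j => polarization u v (mvPolynomialX (Fin m) (Fin m) ℚ v j)) =
        mvPolynomialX (Fin m) (Fin m) ℚ u := by
      funext j
      simp [polarization_X]
    rw [hr]
    by_cases h : u = v
    · subst h
      simp
    · rw [if_neg h]
      exact det_updateRow_eq_zero h
  · intro i _ hi
    apply det_eq_zero_of_row_eq_zero i
    intro j
    simp [polarization_X, Ne.symm hi]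
  · simp

theorem polarization_det_pow {m : ℕ} (s : ℕ) (u v : Fin m) :
    polarization u v ((mvPolynomialX (Fin m) (Fin m) ℚ).det ^ s) =
      (if u = v then (s : ℚ) else 0) • (mvPolynomialX (Fin m) (Fin m) ℚ).det ^ s := by
  rw [Derivation.leibniz_pow, polarization_det]
  by_cases h : u = v
  · cases s with
    | zero => simp
    | succ s => simp [h, pow_succ, MvPolynomial.smul_eq_C_mul]
  · simp [h]

/-- The normally ordered product of the polarization operators from `v i` to `u i`. -/
noncomputable def normalOrdered {m k : ℕ} (u v : Fin k → Fin m)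
    (f : MvPolynomial (Fin m × Fin m) ℚ) : MvPolynomial (Fin m × Fin m) ℚ :=
  ∑ a : Fin k → Fin m, (∏ i, X (u i, a i)) * iteratedPDeriv (fun i => (v i, a i)) f

theorem normalOrdered_zero {m : ℕ} (u v : Fin 0 → Fin m) (f : MvPolynomial (Fin m × Fin m) ℚ) :
    normalOrdered u v f = f := by
  simp [normalOrdered, iteratedPDeriv]

theorem polarization_prod_X {m k : ℕ} (u₀ v₀ : Fin m) (u a : Fin k → Fin m) :
    polarization u₀ v₀ (∏ i, X (u i, a i)) =
      ∑ i, if v₀ = u i then ∏ j, X (Function.update u i u₀ j, a j) else 0 := by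
  rw [derivation_prod]
  refine Finset.sum_congr rfl fun i _ => ?_
  rw [polarization_X]
  split_ifs with h
  · refine Finset.prod_congr rfl fun j _ => ?_
    by_cases hj : j = i
    · subst hj
      simp
    · simp [hj]
  · exact Finset.prod_eq_zero (Finset.mem_univ i) (by simp)

/-- By the Leibniz rule, a polarization applied to a normally ordered product acts either on the
derivatives of `f`, which gives the longer normally ordered product, or on one of the variables in
front, which gives the correction terms. -/
theorem normalOrdered_succ {m k : ℕ} (u v : Fin (k + 1) → Fin m)
    (f : MvPolynomial (Fin m × Fin m) ℚ) :
    normalOrdered u v f = polarization (u 0) (v 0) (normalOrdered (Fin.tail u) (Fin.tail v) f) -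
      ∑ i, if v 0 = Fin.tail u i then
        normalOrdered (Function.update (Fin.tail u) i (u 0)) (Fin.tail v) f else 0 := by
  have h1 : normalOrdered u v f = ∑ a : Fin k → Fin m, (∏ i, X (Fin.tail u i, a i)) *
      polarization (u 0) (v 0) (iteratedPDeriv (fun i => (Fin.tail v i, a i)) f) := by
    rw [normalOrdered, ← (Fin.consEquiv fun _ => Fin m).sum_comp, Fintype.sum_prod_type,
      Finset.sum_comm]
    refine Finset.sum_congr rfl fun a _ => ?_
    rw [polarization_apply, Finset.mul_sum]
    refine Finset.sum_congr rfl fun b _ => ?_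
    rw [Fin.prod_univ_succ]
    simp only [Fin.consEquiv_apply, Fin.cons_zero, Fin.cons_succ, iteratedPDeriv, Fin.tail_def,
      LinearMap.comp_apply]
    rw [Derivation.coeFn_coe]
    ring
  rw [h1]
  simp only [normalOrdered]
  rw [map_sum, eq_sub_iff_add_eq]
  simp_rw [Derivation.leibniz, smul_eq_mul, polarization_prod_X, Finset.sum_add_distrib]
  congr 1
  simp_rw [Finset.mul_sum]
  rw [Finset.sum_comm]
  refine Finset.sum_congr rfl fun i _ => ?_
  split_ifs with h
  · exact Finset.sum_congr rfl fun a _ => mul_comm _ _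
  · simp

/-- The line spanned by `f` is preserved, so in the recursion the outer polarization acts by its
eigenvalue on `f`. -/
theorem normalOrdered_eq_smul {m : ℕ} {s : ℚ} {f : MvPolynomial (Fin m × Fin m) ℚ}
    (hf : ∀ u v, polarization u v f = (if u = v then s else 0) • f) {k : ℕ}
    (u v : Fin k → Fin m) : ∃ c : ℚ, normalOrdered u v f = c • f := by
  induction k with
  | zero => exact ⟨1, by rw [normalOrdered_zero, one_smul]⟩
  | succ k ih =>
    choose c hc using fun u' => ih u' (Fin.tail v)
    refine ⟨c (Fin.tail u) * (if u 0 = v 0 then s else 0) - ∑ i, if v 0 = Fin.tail u i then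
      c (Function.update (Fin.tail u) i (u 0)) else 0, ?_⟩
    rw [normalOrdered_succ, hc, Derivation.map_smul, hf, smul_smul, sub_smul, Finset.sum_smul]
    congr 1
    refine Finset.sum_congr rfl fun i _ => ?_
    rw [hc, ite_smul, zero_smul]

theorem normalOrdered_succ_of_eigen {m : ℕ} {s : ℚ} {f : MvPolynomial (Fin m × Fin m) ℚ}
    (hf : ∀ u v, polarization u v f = (if u = v then s else 0) • f) {k : ℕ}
    (u v : Fin (k + 1) → Fin m) :
    normalOrdered u v f = (if u 0 = v 0 then s else 0) •
        normalOrdered (Fin.tail u) (Fin.tail v) f -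
      ∑ i, if v 0 = Fin.tail u i then
        normalOrdered (Function.update (Fin.tail u) i (u 0)) (Fin.tail v) f else 0 := by
  obtain ⟨c, hc⟩ := normalOrdered_eq_smul hf (Fin.tail u) (Fin.tail v)
  rw [normalOrdered_succ, hc, Derivation.map_smul, hf, smul_comm]

/-- Split `σ` by `p = σ 0`. The choice `p = 0` contributes the eigenvalue `s`; each of the `k`
others contributes `1`, so each induction step gains the factor `s + k`. -/
theorem sum_sign_normalOrdered {m : ℕ} {s : ℚ} {f : MvPolynomial (Fin m × Fin m) ℚ}
    (hf : ∀ u v, polarization u v f = (if u = v then s else 0) • f) {k : ℕ}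
    (v : Fin k → Fin m) (hv : Function.Injective v) :
    ∑ σ : Perm (Fin k), ((Perm.sign σ : ℤ) : ℚ) • normalOrdered (v ∘ σ) v f =
      (∏ i ∈ Finset.range k, (s + i)) • f := by
  induction k with
  | zero => simp [normalOrdered_zero]
  | succ k ih =>
    have hv' : Function.Injective (Fin.tail v) := hv.comp (Fin.succ_injective k)
    have key : ∀ (p : Fin (k + 1)) (e : Perm (Fin k)),
        ((Perm.sign (Perm.decomposeFin.symm (p, e)) : ℤ) : ℚ) •
          normalOrdered (v ∘ Perm.decomposeFin.symm (p, e)) v f =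
        (if p = 0 then s else 1) •
          ((Perm.sign e : ℤ) : ℚ) • normalOrdered (Fin.tail v ∘ e) (Fin.tail v) f := by
      intro p e
      have h0 : (v ∘ Perm.decomposeFin.symm (p, e)) 0 = v p := by simp
      rw [normalOrdered_succ_of_eigen hf, h0, Perm.decomposeFin.symm_sign]
      refine Fin.cases ?_ (fun q => ?_) p
      · have ht : Fin.tail (v ∘ Perm.decomposeFin.symm (0, e)) = Fin.tail v ∘ e := by
          funext i
          simp [Fin.tail]
        rw [ht]
        have hz : ∀ i, v 0 ≠ (Fin.tail v ∘ e) i := fun i h =>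
          Fin.succ_ne_zero _ (hv h).symm
        simp only [hz, if_false, Finset.sum_const_zero, sub_zero, if_true, one_mul]
        rw [smul_comm]
      · have ht : ∀ i, Fin.tail (v ∘ Perm.decomposeFin.symm (q.succ, e)) i =
            v (swap 0 q.succ (e i).succ) := fun i => by simp [Fin.tail]
        have hne : v q.succ ≠ v 0 := fun h => Fin.succ_ne_zero _ (hv h)
        -- Only the correction at the position where `v 0` now sits survives; its minus sign cancels
        -- the sign of the transposition.
        rw [if_neg hne, zero_smul, zero_sub, Finset.sum_eq_single (e.symm q)]
        · have hu : Function.update (Fin.tail (v ∘ Perm.decomposeFin.symm (q.succ, e)))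
              (e.symm q) (v q.succ) = Fin.tail v ∘ e := by
            funext i
            by_cases hi : i = e.symm q
            · subst hi
              simp [Fin.tail]
            · have hq : e i ≠ q := fun h => hi (by simp [← h])
              rw [Function.update_of_ne hi, ht,
                swap_apply_of_ne_of_ne (Fin.succ_ne_zero _) (by simpa using hq)]
              rfl
          have hp : v 0 = Fin.tail (v ∘ Perm.decomposeFin.symm (q.succ, e)) (e.symm q) := by
            rw [ht]
            simp
          rw [if_pos hp, hu]
          simp [Fin.succ_ne_zero]
        · intro i _ hi
          have hq : e i ≠ q := fun h => hi (by simp [← h])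
          rw [if_neg]
          rw [ht, swap_apply_of_ne_of_ne (Fin.succ_ne_zero _) (by simpa using hq)]
          exact fun h => Fin.succ_ne_zero _ (hv h).symm
        · simp
    rw [← Perm.decomposeFin.symm.sum_comp, Fintype.sum_prod_type]
    simp_rw [key, ← Finset.smul_sum, ih _ hv', ← Finset.sum_smul]
    rw [smul_smul, Fin.sum_univ_succ, Finset.prod_range_succ]
    congr 1
    simp [Fin.succ_ne_zero, mul_comm]

/-! ### Cayley's identity -/

/-- The determinant of the matrix of partial derivatives. -/
noncomputable def cayleyOmega {m : ℕ} (f : MvPolynomial (Fin m × Fin m) ℚ) :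
    MvPolynomial (Fin m × Fin m) ℚ :=
  ∑ τ : Perm (Fin m), ((Perm.sign τ : ℤ) : ℚ) • iteratedPDeriv (fun i => (i, τ i)) f

theorem det_mul_cayleyOmega {m : ℕ} (f : MvPolynomial (Fin m × Fin m) ℚ) :
    (mvPolynomialX (Fin m) (Fin m) ℚ).det * cayleyOmega f =
      ∑ σ : Perm (Fin m), ((Perm.sign σ : ℤ) : ℚ) • normalOrdered σ id f := by
  have hdet : ∀ a : Fin m → Fin m, ∑ σ : Perm (Fin m), ((Perm.sign σ : ℤ) : ℚ) •
      ∏ i, (X (σ i, a i) : MvPolynomial (Fin m × Fin m) ℚ) =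
        ((mvPolynomialX (Fin m) (Fin m) ℚ).submatrix id a).det := by
    intro a
    rw [det_apply']
    refine Finset.sum_congr rfl fun σ _ => ?_
    simp [MvPolynomial.smul_eq_C_mul]
  simp only [normalOrdered, Finset.smul_sum]
  rw [Finset.sum_comm]
  simp_rw [← smul_mul_assoc, ← Finset.sum_mul, hdet]
  have hinj : ∀ a : Fin m → Fin m, ¬ Function.Injective a →
      ((mvPolynomialX (Fin m) (Fin m) ℚ).submatrix id a).det = 0 := by
    intro a ha
    simp only [Function.Injective, not_forall] at ha
    obtain ⟨i, j, hij, hne⟩ := ha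
    exact det_zero_of_column_eq hne fun k => by simp [hij]
  rw [cayleyOmega, Finset.mul_sum]
  -- Repeated columns kill every non-injective `a`, so only permutations remain.
  refine Finset.sum_of_injOn (fun τ : Perm (Fin m) => (τ : Fin m → Fin m)) ?_ ?_ ?_ ?_
  · exact fun σ _ τ _ h => DFunLike.coe_injective h
  · simp
  · intro a _ ha
    rw [hinj a, zero_mul]
    intro h
    exact ha ⟨Equiv.ofBijective a (Finite.injective_iff_bijective.1 h), by simp, rfl⟩
  · intro τ _
    rw [det_permute', mul_smul_comm, MvPolynomial.smul_eq_C_mul]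
    simp [mul_assoc]

/-- Cayley's identity. -/
theorem cayleyOmega_det_pow (m s : ℕ) :
    cayleyOmega ((mvPolynomialX (Fin m) (Fin m) ℚ).det ^ (s + 1)) =
      (∏ i ∈ Finset.range m, ((s + 1 : ℕ) + i : ℚ)) •
        (mvPolynomialX (Fin m) (Fin m) ℚ).det ^ s := by
  apply mul_left_cancel₀ (det_mvPolynomialX_ne_zero (Fin m) ℚ)
  rw [det_mul_cayleyOmega]
  have h := sum_sign_normalOrdered (polarization_det_pow (m := m) (s + 1)) id
    Function.injective_id
  simp only [Function.id_comp] at h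
  rw [h, pow_succ, mul_smul_comm, mul_comm]

/-! ### The apolar norm of a power of the determinant -/

/-- The apolar pairing of polynomials, for which the monomials are orthogonal and the multiplication
by a variable is adjoint to the partial derivative. -/
noncomputable def apolarPairing (σ : Type*) :
    MvPolynomial σ ℚ →ₗ[ℚ] MvPolynomial σ ℚ →ₗ[ℚ] ℚ :=
  (basisMonomials σ ℚ).constr ℚ fun d =>
    (d.prod fun _ e => (e.factorial : ℚ)) • lcoeff ℚ d

theorem apolarPairing_monomial {σ : Type*} (d : σ →₀ ℕ) (Q : MvPolynomial σ ℚ) :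
    apolarPairing σ (monomial d 1) Q = (d.prod fun _ e => (e.factorial : ℚ)) * coeff d Q := by
  have h := (basisMonomials σ ℚ).constr_basis ℚ (fun d =>
    (d.prod fun _ e => (e.factorial : ℚ)) • lcoeff ℚ d) d
  rw [coe_basisMonomials] at h
  rw [apolarPairing, h]
  simp [lcoeff]

theorem apolarPairing_X_mul {σ : Type*} (i : σ) (P Q : MvPolynomial σ ℚ) :
    apolarPairing σ (X i * P) Q = apolarPairing σ P (pderiv i Q) := by
  classical
  induction P using MvPolynomial.induction_on' with
  | add p q hp hq => simp [mul_add, hp, hq]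
  | monomial d a =>
    have ha : (monomial d a : MvPolynomial σ ℚ) = a • monomial d 1 := by
      simp [smul_monomial]
    have hd : (X i * monomial d 1 : MvPolynomial σ ℚ) = monomial (d + Finsupp.single i 1) 1 := by
      rw [X, monomial_mul, one_mul, add_comm]
    rw [ha, mul_smul_comm, map_smul, map_smul, LinearMap.smul_apply, LinearMap.smul_apply, hd,
      apolarPairing_monomial, apolarPairing_monomial, coeff_pderiv]
    have hf : ((d + Finsupp.single i 1).prod fun _ e => (e.factorial : ℚ)) =
        (d i + 1) * d.prod fun _ e => (e.factorial : ℚ) := by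
      rw [← Finsupp.mul_prod_erase' (d + Finsupp.single i 1) i _ (by simp),
        ← Finsupp.mul_prod_erase' d i _ (by simp), Finsupp.erase_add, Finsupp.erase_single,
        add_zero, Finsupp.add_apply, Finsupp.single_eq_same, Nat.factorial_succ]
      push_cast
      ring
    rw [hf]
    ring_nf

theorem apolarPairing_prod_X_mul {σ : Type*} {k : ℕ} (w : Fin k → σ) (P Q : MvPolynomial σ ℚ) :
    apolarPairing σ ((∏ i, X (w i)) * P) Q = apolarPairing σ P (iteratedPDeriv w Q) := by
  induction k generalizing P with
  | zero => simp [iteratedPDeriv]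
  | succ k ih =>
    rw [Fin.prod_univ_succ, mul_comm (X (w 0)), mul_assoc]
    refine (ih (Fin.tail w) _).trans ?_
    rw [apolarPairing_X_mul]
    rfl

theorem apolarPairing_det_mul {m : ℕ} (P Q : MvPolynomial (Fin m × Fin m) ℚ) :
    apolarPairing _ ((mvPolynomialX (Fin m) (Fin m) ℚ).det * P) Q =
      apolarPairing _ P (cayleyOmega Q) := by
  rw [← det_transpose, det_apply', cayleyOmega, Finset.sum_mul, map_sum, map_sum,
    LinearMap.sum_apply]
  refine Finset.sum_congr rfl fun τ _ => ?_
  have h : ((Perm.sign τ : ℤ) : MvPolynomial (Fin m × Fin m) ℚ) *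
      (∏ i, (mvPolynomialX (Fin m) (Fin m) ℚ)ᵀ (τ i) i) * P =
      ((Perm.sign τ : ℤ) : ℚ) • ((∏ i, X (i, τ i)) * P) := by
    simp [MvPolynomial.smul_eq_C_mul, mul_assoc]
  rw [h, map_smul, map_smul, LinearMap.smul_apply, apolarPairing_prod_X_mul]

theorem apolarPairing_det_pow (m n : ℕ) :
    apolarPairing _ ((mvPolynomialX (Fin m) (Fin m) ℚ).det ^ n)
      ((mvPolynomialX (Fin m) (Fin m) ℚ).det ^ n) = hookProduct m n := by
  induction n with
  | zero =>
    rw [pow_zero, ← MvPolynomial.C_1, ← MvPolynomial.monomial_zero', apolarPairing_monomial]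
    simp [hookProduct]
  | succ n ih =>
    nth_rewrite 1 [pow_succ']
    rw [apolarPairing_det_mul, cayleyOmega_det_pow, map_smul, ih, hookProduct, hookProduct,
      Finset.prod_range_succ, smul_eq_mul, mul_comm]
    congr 1
    -- Cayley's factor `(n + 1) ⋯ (n + m)` is the new factor `(m + n)! / n!` of the hook product.
    rw [eq_div_iff (by positivity), add_comm m n, ← Nat.factorial_mul_ascFactorial,
      Nat.ascFactorial_eq_prod_range]
    push_cast
    ring

/-- The pairing of two monomials given as products counts the bijections matching the factors. -/
theorem apolarPairing_prod_X_prod_X {σ ι : Type*} [DecidableEq σ] [Fintype ι] [DecidableEq ι]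
    (w v : ι → σ) :
    apolarPairing σ (∏ i, X (w i)) (∏ i, X (v i)) =
      ∑ q : Perm ι, ∏ i, if w i = v (q i) then 1 else 0 := by
  have h : ∀ (k : ℕ) (w v : Fin k → σ), apolarPairing σ (∏ i, X (w i)) (∏ i, X (v i)) =
      ∑ q : Perm (Fin k), ∏ i, if w i = v (q i) then 1 else 0 := by
    intro k
    induction k with
    | zero =>
      intro w v
      simp only [Finset.univ_eq_empty, Finset.prod_empty]
      rw [← MvPolynomial.C_1, ← MvPolynomial.monomial_zero', apolarPairing_monomial]
      simp
    | succ k ih =>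
      intro w v
      rw [Fin.prod_univ_succ, apolarPairing_X_mul, derivation_prod, map_sum,
        ← Perm.decomposeFin.symm.sum_comp, Fintype.sum_prod_type]
      refine Finset.sum_congr rfl fun p _ => ?_
      have hp : ∏ j, Function.update (fun i => (X (v i) : MvPolynomial σ ℚ)) p
          (pderiv (w 0) (X (v p))) j = (if w 0 = v p then (1 : ℚ) else 0) •
            ∏ i : Fin k, X (v (swap 0 p i.succ)) := by
        -- The swap moves the differentiated factor to position `0`, as in `Perm.decomposeFin`.
        rw [← Equiv.prod_comp (swap 0 p), Fin.prod_univ_succ, swap_apply_left, Function.update_self,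
          pderiv_X, Pi.single_apply]
        have : ∀ i : Fin k, swap 0 p i.succ ≠ p := fun i h =>
          Fin.succ_ne_zero i (by simpa using congrArg (swap 0 p) h)
        simp only [this, ne_eq, not_false_eq_true, Function.update_of_ne]
        split_ifs <;> simp_all
      rw [hp, map_smul, ih, smul_eq_mul, Finset.mul_sum]
      refine Finset.sum_congr rfl fun e _ => ?_
      simp [Fin.prod_univ_succ]
  let e := Fintype.equivFin ι
  rw [← e.symm.prod_comp, ← e.symm.prod_comp (fun i => X (v i)), h, ← e.permCongr.sum_comp]
  refine Finset.sum_congr rfl fun q _ => ?_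
  rw [← e.symm.prod_comp]
  simp

/-! ### Signs of cell maps and the universal constant -/

theorem det_apply_row {A ι : Type*} [CommRing A] [Fintype ι] [DecidableEq ι] (M : Matrix ι ι A) :
    M.det = ∑ σ : Perm ι, ((Perm.sign σ : ℤ) : A) * ∏ i, M i (σ i) := by
  rw [← det_transpose, det_apply']
  rfl

/-- The sign of a self-map: the signature if it is bijective, and zero otherwise. -/
def mapSign {ι : Type*} [Fintype ι] [DecidableEq ι] (f : ι → ι) : ℚ :=
  ((1 : Matrix ι ι ℚ).submatrix id f).det

theorem mapSign_eq_sum {ι : Type*} [Fintype ι] [DecidableEq ι] (f : ι → ι) :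
    mapSign f = ∑ σ : Perm ι, ((Perm.sign σ : ℤ) : ℚ) * ∏ i, if f i = σ i then 1 else 0 := by
  rw [mapSign, det_apply']
  simp [Matrix.one_apply, eq_comm]

theorem det_submatrix_id {R ι : Type*} [CommRing R] [Algebra ℚ R] [Fintype ι] [DecidableEq ι]
    (M : Matrix ι ι R) (f : ι → ι) :
    (M.submatrix id f).det = algebraMap ℚ R (mapSign f) * M.det := by
  have h : M.submatrix id f = M * ((1 : Matrix ι ι ℚ).submatrix id f).map (algebraMap ℚ R) := by
    ext i j
    simp [Matrix.mul_apply, Matrix.one_apply]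
  rw [h, det_mul, mul_comm, mapSign, RingHom.map_det]
  rfl

/-- The map of the cells of an `m × n` rectangle with the first component permuted within the
columns and the second one within the rows. -/
def cellMap {m n : ℕ} (τ : Fin n → Perm (Fin m)) (ρ : Fin m → Perm (Fin n)) :
    Fin m × Fin n → Fin m × Fin n :=
  fun c => (τ c.2 c.1, ρ c.1 c.2)

theorem det_pow_eq_sum (m n : ℕ) :
    (mvPolynomialX (Fin m) (Fin m) ℚ).det ^ n =
      ∑ τ : Fin n → Perm (Fin m), (∏ j, ((Perm.sign (τ j) : ℤ) : ℚ)) •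
        ∏ c : Fin m × Fin n, X (c.1, τ c.2 c.1) := by
  have h := Fin.prod_const n (mvPolynomialX (Fin m) (Fin m) ℚ).det
  rw [← h, det_apply_row, Fintype.prod_sum]
  refine Finset.sum_congr rfl fun τ _ => ?_
  rw [Fintype.prod_prod_type_right, Finset.prod_mul_distrib, MvPolynomial.smul_eq_C_mul]
  simp

theorem sum_perm_prod_of_fst {α β : Type*} [Fintype α] [DecidableEq α] [Fintype β] [DecidableEq β]
    (F : Perm (α × β) → ℚ) (hF : ∀ q, (∃ c, (q c).1 ≠ c.1) → F q = 0) :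
    ∑ q, F q = ∑ ρ : α → Perm β, F (prodCongrRight ρ) := by
  symm
  refine Finset.sum_of_injOn (fun ρ : α → Perm β => prodCongrRight ρ) ?_ (by simp) ?_ (by simp)
  · intro ρ _ ρ' _ h
    funext a
    ext b
    have := congrArg Prod.snd (Equiv.congr_fun h (a, b))
    simpa using this
  · intro q _ hq
    apply hF
    by_contra! hc
    have hs : ∀ c, (q.symm c).1 = c.1 := fun c => by
      have := hc (q.symm c)
      rw [apply_symm_apply] at this
      exact this.symm
    refine hq ⟨fun a => ⟨fun b => (q (a, b)).2, fun b => (q.symm (a, b)).2, ?_, ?_⟩, by simp, ?_⟩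
    · intro b
      have : (a, (q (a, b)).2) = q (a, b) := Prod.ext (hc (a, b)).symm rfl
      simp [this]
    · intro b
      have : (a, (q.symm (a, b)).2) = q.symm (a, b) := Prod.ext (hs (a, b)).symm rfl
      simp [this]
    · ext c
      · simp [hc]
      · simp

/-- Undoing the row permutations `ρ` turns the cell map into one that preserves columns. Its matrix
is block diagonal, with one block per column. -/
theorem mapSign_cellMap {m n : ℕ} (τ : Fin n → Perm (Fin m)) (ρ : Fin m → Perm (Fin n)) :
    (∏ i, ((Perm.sign (ρ i) : ℤ) : ℚ)) * mapSign (cellMap τ ρ) =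
      ∏ j, mapSign fun i => τ ((ρ i).symm j) i := by
  have h1 : (1 : Matrix (Fin m × Fin n) (Fin m × Fin n) ℚ).submatrix id (cellMap τ ρ) =
      (blockDiagonal fun j => (1 : Matrix (Fin m) (Fin m) ℚ).submatrix id
        fun i => τ ((ρ i).symm j) i).submatrix id (prodCongrRight ρ) := by
    ext ⟨i, j⟩ ⟨i', j'⟩
    simp only [submatrix_apply, id, Matrix.one_apply, blockDiagonal_apply, cellMap,
      prodCongrRight_apply, Prod.mk.injEq]
    by_cases h : j = ρ i' j' <;> simp [h]
  have h2 : (∏ i, ((Perm.sign (ρ i) : ℤ) : ℚ)) * (∏ i, ((Perm.sign (ρ i) : ℤ) : ℚ)) = 1 := by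
    rw [← Finset.prod_mul_distrib]
    refine Finset.prod_eq_one fun i _ => ?_
    rw [← Int.cast_mul, Int.units_coe_mul_self, Int.cast_one]
  rw [mapSign, h1, det_permute', det_blockDiagonal, Perm.sign_prodCongrRight, ← mul_assoc]
  simp only [Units.coe_prod, Int.cast_prod]
  rw [h2, one_mul]
  rfl

/-- Pair the expansion of `det ^ n` with itself. A matching of the variables of two monomials must
preserve the row index, so it is a family `ρ` of row permutations; summing over the second expansion
leaves the signs of `mapSign_cellMap`. -/
theorem sum_sign_mapSign_cellMap (m n : ℕ) :
    ∑ τ : Fin n → Perm (Fin m), ∑ ρ : Fin m → Perm (Fin n),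
      (∏ j, ((Perm.sign (τ j) : ℤ) : ℚ)) * (∏ i, ((Perm.sign (ρ i) : ℤ) : ℚ)) *
        mapSign (cellMap τ ρ) = hookProduct m n := by
  rw [← apolarPairing_det_pow, det_pow_eq_sum, map_sum (apolarPairing _), LinearMap.sum_apply]
  refine Finset.sum_congr rfl fun τ _ => ?_
  simp_rw [mul_assoc, mapSign_cellMap]
  rw [map_smul, LinearMap.smul_apply, smul_eq_mul, ← Finset.mul_sum, map_sum]
  congr 1
  have hp : ∀ τ' : Fin n → Perm (Fin m),
      apolarPairing _ (∏ c : Fin m × Fin n, X (c.1, τ c.2 c.1))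
        ((∏ j, ((Perm.sign (τ' j) : ℤ) : ℚ)) • ∏ c : Fin m × Fin n, X (c.1, τ' c.2 c.1)) =
      ∑ ρ : Fin m → Perm (Fin n), ∏ j, (((Perm.sign (τ' j) : ℤ) : ℚ) *
        ∏ i, if τ ((ρ i).symm j) i = τ' j i then 1 else 0) := by
    intro τ'
    rw [map_smul, apolarPairing_prod_X_prod_X, sum_perm_prod_of_fst, smul_eq_mul, Finset.mul_sum]
    · refine Finset.sum_congr rfl fun ρ _ => ?_
      rw [Finset.prod_mul_distrib, Fintype.prod_prod_type]
      congr 1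
      conv_rhs => rw [Finset.prod_comm]
      refine Finset.prod_congr rfl fun i _ => ?_
      rw [← Equiv.prod_comp (ρ i) fun j => if τ ((ρ i).symm j) i = τ' j i then (1 : ℚ) else 0]
      simp
    · rintro q ⟨c, hc⟩
      refine Finset.prod_eq_zero (Finset.mem_univ c) (if_neg fun h => hc ?_)
      exact (congrArg Prod.fst h).symm
  simp_rw [hp]
  rw [Finset.sum_comm]
  refine Finset.sum_congr rfl fun ρ _ => ?_
  simp_rw [mapSign_eq_sum, Fintype.prod_sum]

theorem sum_sign_prod_det_mul_prod_det {R : Type*} [CommRing R] [Algebra ℚ R] {m n : ℕ}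
    (A : Fin m × Fin n → Fin m → R) (B : Fin m × Fin n → Fin n → R) :
    ∑ σ : Perm (Fin m × Fin n), ((Perm.sign σ : ℤ) : R) *
      ((∏ j, (of fun i i' => A (σ (i, j)) i').det) * ∏ i, (of fun j j' => B (σ (i, j)) j').det) =
      algebraMap ℚ R (hookProduct m n) * (of fun c d => A c d.1 * B c d.2).det := by
  have h : ∀ σ : Perm (Fin m × Fin n), ((Perm.sign σ : ℤ) : R) *
      ((∏ j, (of fun i i' => A (σ (i, j)) i').det) *
        ∏ i, (of fun j j' => B (σ (i, j)) j').det) =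
      ∑ τ : Fin n → Perm (Fin m), ∑ ρ : Fin m → Perm (Fin n),
        algebraMap ℚ R (∏ j, ((Perm.sign (τ j) : ℤ) : ℚ)) *
          algebraMap ℚ R (∏ i, ((Perm.sign (ρ i) : ℤ) : ℚ)) *
          (((Perm.sign σ : ℤ) : R) * ∏ c, (of fun c d : Fin m × Fin n => A c d.1 * B c d.2).submatrix
            id (cellMap τ ρ) (σ c) c) := by
    intro σ
    simp_rw [det_apply_row]
    rw [Fintype.prod_sum, Fintype.prod_sum, Finset.sum_mul_sum, Finset.mul_sum]
    refine Finset.sum_congr rfl fun τ _ => ?_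
    rw [Finset.mul_sum]
    refine Finset.sum_congr rfl fun ρ _ => ?_
    simp only [submatrix_apply, of_apply, id, cellMap, Finset.prod_mul_distrib, map_prod,
      map_intCast]
    rw [Fintype.prod_prod_type_right, Fintype.prod_prod_type]
    ring
  rw [Finset.sum_congr rfl fun σ _ => h σ, Finset.sum_comm, ← sum_sign_mapSign_cellMap, map_sum,
    Finset.sum_mul]
  refine Finset.sum_congr rfl fun τ _ => ?_
  rw [Finset.sum_comm, map_sum, Finset.sum_mul]
  refine Finset.sum_congr rfl fun ρ _ => ?_
  rw [← Finset.mul_sum, ← det_apply', det_submatrix_id, map_mul, map_mul]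
  simp only [mul_assoc]

/-! ### Kronecker order, tableaux and the change of monomial order -/

/-- The cells of an `m × n` rectangle, numbered as in the trivial tableau. -/
def cellEquiv (m n : ℕ) : Fin m × Fin n ≃ Fin (m * n) :=
  (prodComm _ _).trans (finProdFinEquiv.trans (finCongr (mul_comm n m)))

theorem cellEquiv_apply {m n : ℕ} (i : Fin m) (j : Fin n) :
    cellEquiv m n (i, j) = trivialTableau m n i j := by
  apply Fin.ext
  simp [cellEquiv, trivialTableau]

theorem trivialTableau_val {m n : ℕ} (i : Fin m) (j : Fin n) :
    (trivialTableau m n i j : ℕ) = i + m * j := rfl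

theorem kroneckerEnum_symm_val {r m : ℕ} (N : Fin r → ℕ) (h : m = ∏ i, N i) (a : Expo N) :
    ((kroneckerEnum N h).symm a : ℕ) = ∑ i, (a i : ℕ) * ∏ j, N (Fin.castLE i.is_lt.le j) := by
  simp [kroneckerEnum, finPiFinEquiv_apply]

/-- Positions are mixed-radix numbers: every place value of the second group contains the full
product `m` of the first. -/
theorem kroneckerEnum_symm_val_eq {k l m n : ℕ} {N : Fin (k + l) → ℕ}
    (hm : m = ∏ i, firstPart N i) (hn : n = ∏ j, secondPart N j) (a : Expo N) :
    ((kroneckerEnum N (mul_eq_prod hm hn)).symm a : ℕ) =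
      (kroneckerEnum (firstPart N) hm).symm (fun i => a (Fin.castAdd l i)) +
        m * (kroneckerEnum (secondPart N) hn).symm (fun j => a (Fin.natAdd k j)) := by
  rw [kroneckerEnum_symm_val, kroneckerEnum_symm_val, kroneckerEnum_symm_val, Fin.sum_univ_add,
    Finset.mul_sum]
  congr 1
  refine Finset.sum_congr rfl fun j _ => ?_
  have h : ∏ i : Fin (k + j), N (Fin.castLE (Fin.natAdd k j).is_lt.le i) =
      m * ∏ i : Fin j, secondPart N (Fin.castLE j.is_lt.le i) := by
    rw [hm, Fin.prod_univ_add]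
    rfl
  calc _ = (a (Fin.natAdd k j) : ℕ) *
        ∏ i : Fin (k + j), N (Fin.castLE (Fin.natAdd k j).is_lt.le i) := rfl
    _ = _ := by
      rw [h]
      ring

theorem kroneckerEnum_trivialTableau {k l m n : ℕ} {N : Fin (k + l) → ℕ}
    (hm : m = ∏ i, firstPart N i) (hn : n = ∏ j, secondPart N j) (i : Fin m) (j : Fin n) :
    (∀ x, kroneckerEnum N (mul_eq_prod hm hn) (trivialTableau m n i j) (Fin.castAdd l x) =
      kroneckerEnum (firstPart N) hm i x) ∧
    ∀ y, kroneckerEnum N (mul_eq_prod hm hn) (trivialTableau m n i j) (Fin.natAdd k y) =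
      kroneckerEnum (secondPart N) hn j y := by
  set a := kroneckerEnum N (mul_eq_prod hm hn) (trivialTableau m n i j) with ha
  have h := kroneckerEnum_symm_val_eq hm hn a
  rw [ha, symm_apply_apply, ← ha, trivialTableau_val] at h
  set p := (kroneckerEnum (firstPart N) hm).symm fun x => a (Fin.castAdd l x) with hp
  set q := (kroneckerEnum (secondPart N) hn).symm fun y => a (Fin.natAdd k y) with hq
  have hpq : cellEquiv m n (i, j) = cellEquiv m n (p, q) := by
    rw [cellEquiv_apply, cellEquiv_apply]
    exact Fin.ext h
  have hpq' := (cellEquiv m n).injective hpq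
  rw [Prod.mk.injEq] at hpq'
  constructor
  · intro x
    rw [hpq'.1, hp, apply_symm_apply]
  · intro y
    rw [hpq'.2, hq, apply_symm_apply]

theorem monomialAt_kroneckerEnum {R : Type*} [CommRing R] {k l m n : ℕ} {N : Fin (k + l) → ℕ}
    (hm : m = ∏ i, firstPart N i) (hn : n = ∏ j, secondPart N j) (i : Fin m) (j : Fin n)
    (z : Fin (k + l) → R) :
    monomialAt (kroneckerEnum N (mul_eq_prod hm hn) (trivialTableau m n i j)) z =
      monomialAt (kroneckerEnum (firstPart N) hm i) (firstPart z) *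
        monomialAt (kroneckerEnum (secondPart N) hn j) (secondPart z) := by
  obtain ⟨h1, h2⟩ := kroneckerEnum_trivialTableau hm hn i j
  simp only [monomialAt, Fin.prod_univ_add, h1, h2]

theorem hookProduct_ne_zero (m n : ℕ) : hookProduct m n ≠ 0 :=
  Finset.prod_ne_zero_iff.2 fun _ _ => by positivity

theorem det_vandermonde_kroneckerEnum {R : Type*} [CommRing R] [Algebra ℚ R] {k l m n : ℕ}
    (N : Fin (k + l) → ℕ) (hm : m = ∏ i, firstPart N i) (hn : n = ∏ j, secondPart N j)
    (z : Fin (m * n) → Fin (k + l) → R) :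
    (vandermonde (kroneckerEnum N (mul_eq_prod hm hn)) z).det =
      (1 / hookProduct m n) •
        tableauSum (kroneckerEnum (firstPart N) hm) (kroneckerEnum (secondPart N) hn) z := by
  have h := sum_sign_prod_det_mul_prod_det
    (fun c i => monomialAt (kroneckerEnum (firstPart N) hm i) (firstPart (z (cellEquiv m n c))))
    (fun c j => monomialAt (kroneckerEnum (secondPart N) hn j) (secondPart (z (cellEquiv m n c))))
  have hdet : (of fun c d : Fin m × Fin n =>
      monomialAt (kroneckerEnum (firstPart N) hm d.1) (firstPart (z (cellEquiv m n c))) *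
        monomialAt (kroneckerEnum (secondPart N) hn d.2) (secondPart (z (cellEquiv m n c)))).det =
      (vandermonde (kroneckerEnum N (mul_eq_prod hm hn)) z).det := by
    rw [← det_submatrix_equiv_self (cellEquiv m n)]
    congr 1
    ext c ⟨i, j⟩
    simp [vandermonde, cellEquiv_apply, monomialAt_kroneckerEnum hm hn]
  have hsum : tableauSum (kroneckerEnum (firstPart N) hm) (kroneckerEnum (secondPart N) hn) z =
      algebraMap ℚ R (hookProduct m n) *
        (vandermonde (kroneckerEnum N (mul_eq_prod hm hn)) z).det := by
    rw [← hdet, ← h, tableauSum, ← (cellEquiv m n).permCongr.sum_comp]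
    refine Finset.sum_congr rfl fun σ _ => ?_
    simp only [Perm.sign_permCongr, permTableau, tabCol, tabRow, ← cellEquiv_apply,
      permCongr_apply, symm_apply_apply]
    rfl
  rw [hsum, ← Algebra.smul_def, smul_smul, one_div_mul_cancel (hookProduct_ne_zero m n), one_smul]

theorem det_vandermonde_degLexEnum {R : Type*} [CommRing R] {r m : ℕ} (N : Fin r → ℕ)
    (h : m = ∏ i, N i) (z : Fin m → Fin r → R) :
    (vandermonde (degLexEnum N h) z).det =
      ((orderSign N h : ℤ) : R) * (vandermonde (kroneckerEnum N h) z).det := by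
  rw [orderSign, ← det_permute']
  congr 1
  ext i j
  simp [vandermonde]

theorem tableauSum_degLexEnum {R : Type*} [CommRing R] {k l m n : ℕ} (N : Fin (k + l) → ℕ)
    (hm : m = ∏ i, firstPart N i) (hn : n = ∏ j, secondPart N j)
    (z : Fin (m * n) → Fin (k + l) → R) :
    tableauSum (degLexEnum (firstPart N) hm) (degLexEnum (secondPart N) hn) z =
      ((orderSign (firstPart N) hm ^ n * orderSign (secondPart N) hn ^ m : ℤˣ) : ℤ) *
        tableauSum (kroneckerEnum (firstPart N) hm) (kroneckerEnum (secondPart N) hn) z := by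
  rw [tableauSum, tableauSum, Finset.mul_sum]
  refine Finset.sum_congr rfl fun σ _ => ?_
  simp only [det_vandermonde_degLexEnum, Finset.prod_mul_distrib, Finset.prod_const,
    Finset.card_univ, Fintype.card_fin, Units.val_mul, Units.val_pow_eq_pow_val, Int.cast_mul,
    Int.cast_pow]
  ring

end MultiVandermonde

theorem theorem2 {R : Type*} [CommRing R] [Algebra ℚ R] {k l m n : ℕ} (hk : 1 ≤ k) (hl : 1 ≤ l)
    (N : Fin (k + l) → ℕ) (hN : ∀ i, 2 ≤ N i)
    (hm : m = ∏ i, MultiVandermonde.firstPart N i)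
    (hn : n = ∏ j, MultiVandermonde.secondPart N j)
    (hmn : n ≤ m) (z : Fin (m * n) → Fin (k + l) → R) :
    (MultiVandermonde.vandermonde
        (MultiVandermonde.kroneckerEnum N (MultiVandermonde.mul_eq_prod hm hn)) z).det =
      (1 / MultiVandermonde.hookProduct m n) •
        MultiVandermonde.tableauSum (MultiVandermonde.kroneckerEnum (MultiVandermonde.firstPart N) hm)
          (MultiVandermonde.kroneckerEnum (MultiVandermonde.secondPart N) hn) z ∧
    (MultiVandermonde.vandermonde
        (MultiVandermonde.degLexEnum N (MultiVandermonde.mul_eq_prod hm hn)) z).det =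
      (((MultiVandermonde.orderSign N (MultiVandermonde.mul_eq_prod hm hn) *
          MultiVandermonde.orderSign (MultiVandermonde.firstPart N) hm ^ n *
          MultiVandermonde.orderSign (MultiVandermonde.secondPart N) hn ^ m : ℤˣ) : ℤ) : R) *
        ((1 / MultiVandermonde.hookProduct m n) •
          MultiVandermonde.tableauSum (MultiVandermonde.degLexEnum (MultiVandermonde.firstPart N) hm)
            (MultiVandermonde.degLexEnum (MultiVandermonde.secondPart N) hn) z) := by
  refine ⟨MultiVandermonde.det_vandermonde_kroneckerEnum N hm hn z, ?_⟩
  rw [MultiVandermonde.det_vandermonde_degLexEnum,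
    MultiVandermonde.det_vandermonde_kroneckerEnum, MultiVandermonde.tableauSum_degLexEnum]
  -- The signs `b` from the rows and columns occur twice and cancel, since a unit of `ℤ` squares to
  -- one.
  have h : ∀ (a b : ℤˣ) (x : R), ((a : ℤ) : R) * x = (((a * b : ℤˣ) : ℤ) : R) *
      (((b : ℤ) : R) * x) := fun a b x => by
    rw [← mul_assoc, ← Int.cast_mul, ← Units.val_mul, mul_assoc, Int.units_mul_self, mul_one]
  rw [mul_assoc (MultiVandermonde.orderSign N _), ← mul_smul_comm]
  exact h _ _ _
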